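/- Let $d,k\in\mathbb N$, $\alpha\in(0,1]$, let $\Omega=(0,1)^d$ with Lebesgue measure and $\mathbb H=L^2(\Omega;\mathbb R^d)$. For a real normed space $E$, let $C^{2,\alpha}_{\rm loc}(E)$ be the space of twice continuously Fréchet differentiable functions $f:E\to\mathbb R$ such that $D^2f$ is $\alpha$-Hölder continuous, in operator norm, on every ball of $E$. For $g\in C^{2,\alpha}_{\rm loc}((\mathbb R^d)^k)$ with $D^2g$ bounded, define $$\tilde\Phi_g(x)=\int_{\Omega^k} g\big(x(\omega_1),\dots,x(\omega_k)\big)\,d\omega_1\cdots d\omega_k,\qquad x\in\mathbb H .$$ Then the set $$C^{2,\alpha}_{\rm loc}(\mathbb H)\cap\big\{\tilde\Phi_g \;:\; g\in C^{2,\alpha}_{\rm loc}((\mathbb R^d)^k),\ \|D^2g\|_{L^\infty}<\infty\big\}$$ is a finite-dimensional linear subspace of the space of real functions on $\mathbb H$. Moreover, if $g\in C^{2,\alpha}_{\rm loc}((\mathbb R^d)^k)$ has bounded $D^2g$ and $\tilde\Phi_g\in C^{2,\alpha}_{\rm loc}(\mathbb H)$, then the symmetrization $$\tilde g(q_1,\dots,q_k)=\frac1{k!}\sum_{\tau}g(q_{\tau(1)},\dots,q_{\tau(k)})$$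 (the sum being over all permutations $\tau$ of $\{1,\dots,k\}$), which is $g$ itself when $g$ is symmetric, is a polynomial of total degree at most $2$. -/

import Mathlib

open MeasureTheory

/-- The state space `ℝ^d` with its Euclidean norm. -/
abbrev StateSpace (d : ℕ) : Type := EuclideanSpace ℝ (Fin d)

/-- The open unit cube `Ω = (0,1)^d`. -/
def unitCube (d : ℕ) : Set (EuclideanSpace ℝ (Fin d)) :=
  {ω | ∀ i, ω i ∈ Set.Ioo (0 : ℝ) 1}

/-- Lebesgue measure restricted to the unit cube. -/
noncomputable def cubeMeasure (d : ℕ) : Measure (EuclideanSpace ℝ (Fin d)) :=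
  volume.restrict (unitCube d)

/-- The Hilbert space `L²((0,1)^d; ℝ^d)`. -/
abbrev HilbertH (d : ℕ) : Type := Lp (StateSpace d) 2 (cubeMeasure d)

/-- The class `C^{2,α}_loc`: twice continuously Fréchet differentiable real functions whose second
derivative is `α`-Hölder continuous (in operator norm) on every ball. -/
def IsC2AlphaLoc {E : Type*} [NormedAddCommGroup E] [NormedSpace ℝ E] (α : ℝ) (f : E → ℝ) : Prop :=
  ContDiff ℝ 2 f ∧
    ∀ r : ℝ, 0 < r → ∃ C : ℝ, ∀ x ∈ Metric.closedBall (0 : E) r, ∀ y ∈ Metric.closedBall (0 : E) r,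
      ‖fderiv ℝ (fderiv ℝ f) x - fderiv ℝ (fderiv ℝ f) y‖ ≤ C * ‖x - y‖ ^ α

/-- The second derivative of `f` is bounded. -/
def HasBoundedHessian {E : Type*} [NormedAddCommGroup E] [NormedSpace ℝ E] (f : E → ℝ) : Prop :=
  ∃ C : ℝ, ∀ x : E, ‖fderiv ℝ (fderiv ℝ f) x‖ ≤ C

/-- The admissible integrands: `g ∈ C^{2,α}_loc((ℝ^d)^k)` with bounded second derivative.
(The norm on the finite product is the maximum of the Euclidean norms; as all norms on
`(ℝ^d)^k` are equivalent, this does not affect the class.) -/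
def IsAdmissibleIntegrand (d k : ℕ) (α : ℝ) (g : (Fin k → StateSpace d) → ℝ) : Prop :=
  IsC2AlphaLoc α g ∧ HasBoundedHessian g

/-- The functional `x ↦ ∫_{Ω^k} g (x(ω₁), …, x(ω_k)) dω₁ ⋯ dω_k` on `L²(Ω; ℝ^d)`. -/
noncomputable def localFunctional (d k : ℕ) (g : (Fin k → StateSpace d) → ℝ)
    (x : HilbertH d) : ℝ :=
  ∫ ω : Fin k → EuclideanSpace ℝ (Fin d), g (fun i => x (ω i))
    ∂(Measure.pi fun _ : Fin k => cubeMeasure d)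

/-- The symmetrization `(1/k!) ∑_τ g (q_{τ(1)}, …, q_{τ(k)})`. -/
noncomputable def symmetrization (d k : ℕ) (g : (Fin k → StateSpace d) → ℝ)
    (q : Fin k → StateSpace d) : ℝ :=
  (1 / (k.factorial : ℝ)) * ∑ τ : Equiv.Perm (Fin k), g (fun i => q (τ i))

/-- `g` is a polynomial, in the `k * d` real coordinates, of total degree at most two. -/
def IsPolynomialDegreeLeTwo (d k : ℕ) (g : (Fin k → StateSpace d) → ℝ) : Prop :=
  ∃ p : MvPolynomial (Fin k × Fin d) ℝ, p.totalDegree ≤ 2 ∧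
    ∀ q : Fin k → StateSpace d, g q = MvPolynomial.eval (fun ij => q ij.1 ij.2) p

/-! Small sets are cheap in `L²`: perturbing `x` by `h` on a cell of volume of order `s²` costs only
`s‖h‖` in norm. If the functional is `C^{2,α}_loc`, its third difference along such a perturbation
is `O(s^{2+α})`. On step maps it is also a finite sum of third differences of `g`, weighted by
products of cell volumes. Taking an alternating sum over the presence of the other cells keeps only
the terms visiting each of the `k` cells once, which leaves `± s²` times a sum over permutations
that does not depend on `s`. Dividing by `s²` and letting `s → 0` kills it
(`sum_perm_thirdDiff_eq_zero`), so the third differences of the symmetrization vanish in each block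
direction. Finite differences are needed because `g` is only `C²`. Along such a direction the
Hessian then follows a bounded sequence polynomial in the step number, hence a constant one. It is
therefore constant everywhere and the symmetrization is quadratic
(`eq_quadratic_of_thirdDiff_single_eq_zero`). Conversely, quadratic integrands give continuous
quadratic functions on `L²` (`exists_localFunctional_quadraticFun_eq`). A functional depends on `g`
only through its symmetrization, so the set is the linear image of a finite-dimensional coefficient
space. -/

/-! ### Third differences, bounded Hessians and quadratic functions. -/

section Calculus

variable {E F : Type*} [NormedAddCommGroup E] [NormedSpace ℝ E]
  [NormedAddCommGroup F] [NormedSpace ℝ F]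

/-- The third finite difference of `f` at `x` with step `h`. -/
def thirdDiff (f : E → F) (x h : E) : F :=
  f (x + (3 : ℝ) • h) - (3 : ℝ) • f (x + (2 : ℝ) • h) + (3 : ℝ) • f (x + h) - f x

/-- Control of the third difference of a function whose derivative is close to an affine map. -/
theorem abs_thirdDiff_le_of_hessian_close {f : E → ℝ} (hf : ContDiff ℝ 2 f) {x h : E} {M : ℝ}
    (hM : ∀ y ∈ Metric.closedBall x (3 * ‖h‖),
      ‖fderiv ℝ (fderiv ℝ f) y - fderiv ℝ (fderiv ℝ f) x‖ ≤ M) :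
    |thirdDiff f x h| ≤ 2 * (M * ‖h‖ * ‖h‖) := by
  set B := fderiv ℝ (fderiv ℝ f) x with hB
  have hd : Differentiable ℝ f := hf.differentiable (by norm_num)
  have hd' : Differentiable ℝ (fderiv ℝ f) :=
    (hf.fderiv_right (m := 1) (by norm_num)).differentiable (by norm_num)
  have h1 : ∀ y ∈ Metric.closedBall x (2 * ‖h‖),
      ‖fderiv ℝ f (y + h) - fderiv ℝ f y - B h‖ ≤ M * ‖h‖ := by
    intro y hy
    have hy' : y ∈ Metric.closedBall x (3 * ‖h‖) :=
      Metric.closedBall_subset_closedBall (by linarith [norm_nonneg h]) hy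
    have hyh : y + h ∈ Metric.closedBall x (3 * ‖h‖) := by
      rw [mem_closedBall_iff_norm] at hy ⊢
      calc ‖y + h - x‖ = ‖(y - x) + h‖ := by congr 1; abel
        _ ≤ ‖y - x‖ + ‖h‖ := norm_add_le _ _
        _ ≤ 3 * ‖h‖ := by linarith
    have := (convex_closedBall x (3 * ‖h‖)).norm_image_sub_le_of_norm_fderiv_le' (𝕜 := ℝ)
      (f := fderiv ℝ f) (φ := B) (C := M) (fun z _ => hd' z) hM hy' hyh
    simpa using this
  have h2 : ∀ y ∈ Metric.closedBall x ‖h‖,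
      |f (y + h + h) - f (y + h) - (f (y + h) - f y) - B h h| ≤ M * ‖h‖ * ‖h‖ := by
    intro y hy
    have hy' : y ∈ Metric.closedBall x (2 * ‖h‖) :=
      Metric.closedBall_subset_closedBall (by linarith [norm_nonneg h]) hy
    have hyh : y + h ∈ Metric.closedBall x (2 * ‖h‖) := by
      rw [mem_closedBall_iff_norm] at hy ⊢
      calc ‖y + h - x‖ = ‖(y - x) + h‖ := by congr 1; abel
        _ ≤ ‖y - x‖ + ‖h‖ := norm_add_le _ _
        _ ≤ 2 * ‖h‖ := by linarith
    have hfd : ∀ z, HasFDerivAt (fun z => f (z + h) - f z)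
        (fderiv ℝ f (z + h) - fderiv ℝ f z) z := fun z =>
      ((hasFDerivAt_comp_add_right h).2 (hd (z + h)).hasFDerivAt).sub (hd z).hasFDerivAt
    have := (convex_closedBall x (2 * ‖h‖)).norm_image_sub_le_of_norm_fderiv_le' (𝕜 := ℝ)
      (f := fun z => f (z + h) - f z) (φ := B h) (C := M * ‖h‖)
      (fun z _ => (hfd z).differentiableAt)
      (fun z hz => by rw [(hfd z).fderiv]; exact h1 z hz) hy' hyh
    simpa using this
  -- The third difference is the second difference at `x + h` minus the one at `x`. Each is close to
  -- `B h h`, hence the factor 2.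
  have e1 := h2 x (Metric.mem_closedBall_self (norm_nonneg _))
  have e2 := h2 (x + h) (by simp)
  have s2 : x + (2 : ℝ) • h = x + h + h := by rw [two_smul]; abel
  have s3 : x + (3 : ℝ) • h = x + h + h + h := by
    rw [show (3 : ℝ) = 1 + 1 + 1 by norm_num, add_smul, add_smul, one_smul]; abel
  simp only [thirdDiff, s2, s3, smul_eq_mul]
  rw [abs_le] at *
  constructor <;> linarith [e1.1, e1.2, e2.1, e2.2]

theorem IsC2AlphaLoc.abs_thirdDiff_le {α : ℝ} (hα : 0 ≤ α) {f : E → ℝ} (hf : IsC2AlphaLoc α f)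
    {r : ℝ} (hr : 0 < r) :
    ∃ C : ℝ, 0 ≤ C ∧ ∀ x h : E, ‖x‖ + 3 * ‖h‖ ≤ r → |thirdDiff f x h| ≤ C * (‖h‖ ^ 2 * ‖h‖ ^ α) := by
  obtain ⟨C, hC⟩ := hf.2 r hr
  refine ⟨2 * (|C| * 3 ^ α), by positivity, fun x h hxh => ?_⟩
  have hxr : x ∈ Metric.closedBall (0 : E) r := by
    rw [mem_closedBall_zero_iff]; linarith [norm_nonneg h]
  refine (abs_thirdDiff_le_of_hessian_close (M := |C| * (3 * ‖h‖) ^ α) hf.1 fun y hy => ?_).trans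
    (le_of_eq ?_)
  · rw [mem_closedBall_iff_norm] at hy
    have hyr : y ∈ Metric.closedBall (0 : E) r := by
      rw [mem_closedBall_zero_iff]
      calc ‖y‖ = ‖x + (y - x)‖ := by congr 1; abel
        _ ≤ ‖x‖ + ‖y - x‖ := norm_add_le _ _
        _ ≤ r := by linarith
    refine (hC y hyr x hxr).trans ?_
    gcongr
    exact le_abs_self C
  · rw [Real.mul_rpow (by norm_num) (norm_nonneg _)]; ring

/-- A bounded sequence whose third differences vanish is constant. -/
theorem eq_of_bounded_of_thirdDiff_eq_zero {u : ℕ → F} {C : ℝ} (hC : ∀ n, ‖u n‖ ≤ C)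
    (hu : ∀ n, u (n + 3) - (3 : ℝ) • u (n + 2) + (3 : ℝ) • u (n + 1) - u n = 0) :
    u 1 = u 0 := by
  have hform : ∀ n : ℕ, u n = u 0 + (n : ℝ) • (u 1 - u 0) +
      ((n : ℝ) * (n - 1) / 2) • (u 2 - (2 : ℝ) • u 1 + u 0) := by
    -- The recurrence has order three, so the induction carries three consecutive terms.
    have key : ∀ n : ℕ, ∀ m ≤ n + 2, u m = u 0 + (m : ℝ) • (u 1 - u 0) +
      ((m : ℝ) * (m - 1) / 2) • (u 2 - (2 : ℝ) • u 1 + u 0) := by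
      intro n
      induction n with
      | zero =>
        intro m hm
        interval_cases m
        · simp
        · simp
        · norm_num
          module
      | succ n ih =>
        intro m hm
        rcases Nat.lt_or_ge m (n + 3) with h | h
        · exact ih m (by omega)
        · obtain rfl : m = n + 3 := by omega
          have h0 : u (n + 3) = (3 : ℝ) • u (n + 2) - (3 : ℝ) • u (n + 1) + u n := by
            have := hu n
            rw [← sub_eq_zero, ← this]; abel
          rw [h0, ih (n + 2) (by omega), ih (n + 1) (by omega), ih n (by omega)]
          push_cast
          module
    exact fun n => key n n (by omega)
  set a := u 1 - u 0
  set b := u 2 - (2 : ℝ) • u 1 + u 0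
  have hC0 : 0 ≤ C := (norm_nonneg _).trans (hC 0)
  have hb : b = 0 := by
    by_contra hb
    have hb' : 0 < ‖b‖ := norm_pos_iff.2 hb
    obtain ⟨n, hn⟩ := exists_nat_gt (4 * C / ‖b‖)
    rw [div_lt_iff₀ hb'] at hn
    have hn1 : (1 : ℝ) ≤ n := by
      have : n ≠ 0 := by
        rintro rfl
        simp at hn
        linarith
      exact_mod_cast Nat.one_le_iff_ne_zero.2 this
    -- This combination cancels the linear coefficient `a`, so quadratic growth is contradicted
    -- first.
    have : ((n : ℝ) * n) • b = u (2 * n) - (2 : ℝ) • u n + u 0 := by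
      rw [hform (2 * n), hform n]
      push_cast
      module
    have h2 : ‖((n : ℝ) * n) • b‖ ≤ 4 * C := by
      rw [this]
      calc ‖u (2 * n) - (2 : ℝ) • u n + u 0‖ ≤ ‖u (2 * n)‖ + ‖(2 : ℝ) • u n‖ + ‖u 0‖ :=
            (norm_add_le _ _).trans (add_le_add_left (norm_sub_le _ _) _)
        _ ≤ C + 2 * C + C := by
            rw [norm_smul]
            gcongr <;> first | exact hC _ | norm_num
        _ = 4 * C := by ring
    rw [norm_smul, Real.norm_of_nonneg (by positivity)] at h2
    nlinarith [mul_nonneg (sub_nonneg.2 hn1) (mul_nonneg (by linarith : (0 : ℝ) ≤ n) hb'.le)]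
  have ha : a = 0 := by
    by_contra ha
    have ha' : 0 < ‖a‖ := norm_pos_iff.2 ha
    obtain ⟨n, hn⟩ := exists_nat_gt (2 * C / ‖a‖)
    rw [div_lt_iff₀ ha'] at hn
    have : (n : ℝ) • a = u n - u 0 := by
      rw [hform n, hb]
      module
    have h2 : ‖(n : ℝ) • a‖ ≤ 2 * C := by
      rw [this]
      linarith [norm_sub_le (u n) (u 0), hC n, hC 0]
    rw [norm_smul, Real.norm_of_nonneg (by positivity)] at h2
    linarith
  exact sub_eq_zero.1 ha

/-- With the step fixed, the third difference is a combination of translates and commutes with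
differentiation in the base point. -/
theorem thirdDiff_fderiv_eq_zero {φ : E → F} (hφ : Differentiable ℝ φ) {h : E}
    (h0 : ∀ x, thirdDiff φ x h = 0) (x : E) : thirdDiff (fderiv ℝ φ) x h = 0 := by
  have ht : ∀ v : E, HasFDerivAt (fun z => φ (z + v)) (fderiv ℝ φ (x + v)) x := fun v =>
    (hasFDerivAt_comp_add_right v).2 (hφ (x + v)).hasFDerivAt
  have := (((ht ((3 : ℝ) • h)).sub ((ht ((2 : ℝ) • h)).const_smul (3 : ℝ))).add
    ((ht h).const_smul (3 : ℝ))).sub (hφ x).hasFDerivAt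
  have hz : HasFDerivAt (fun z => thirdDiff φ z h) (0 : E →L[ℝ] F) x := by
    rw [funext h0]; exact hasFDerivAt_const _ _
  exact this.unique hz

/-- If the third difference of a `C²` function with bounded Hessian vanishes in direction `h`, then
the Hessian is invariant under translation by `h`. -/
theorem hessian_add_eq_of_thirdDiff_eq_zero {f : E → ℝ} (hf : ContDiff ℝ 2 f)
    (hb : HasBoundedHessian f) {h : E} (h3 : ∀ x, thirdDiff f x h = 0) (x : E) :
    fderiv ℝ (fderiv ℝ f) (x + h) = fderiv ℝ (fderiv ℝ f) x := by
  obtain ⟨C, hC⟩ := hb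
  have hd : Differentiable ℝ f := hf.differentiable (by norm_num)
  have hd' : Differentiable ℝ (fderiv ℝ f) :=
    (hf.fderiv_right (m := 1) (by norm_num)).differentiable (by norm_num)
  have h5 := thirdDiff_fderiv_eq_zero hd' (thirdDiff_fderiv_eq_zero hd h3)
  have := eq_of_bounded_of_thirdDiff_eq_zero
    (u := fun n : ℕ => fderiv ℝ (fderiv ℝ f) (x + (n : ℝ) • h)) (fun n => hC _) (fun n => by
      have := h5 (x + (n : ℝ) • h)
      simp only [thirdDiff, add_assoc] at this
      simpa only [Nat.cast_add, Nat.cast_ofNat, Nat.cast_one, add_smul, one_smul] using this)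
  simpa using this

/-- A `C²` function with constant Hessian is a quadratic polynomial. -/
theorem eq_quadratic_of_hessian_const {f : E → ℝ} (hf : ContDiff ℝ 2 f)
    (hc : ∀ x, fderiv ℝ (fderiv ℝ f) x = fderiv ℝ (fderiv ℝ f) 0) (x : E) :
    f x = f 0 + fderiv ℝ f 0 x + ((1 / 2 : ℝ) • fderiv ℝ (fderiv ℝ f) 0) x x := by
  have hd : Differentiable ℝ f := hf.differentiable (by norm_num)
  have hd' : Differentiable ℝ (fderiv ℝ f) :=
    (hf.fderiv_right (m := 1) (by norm_num)).differentiable (by norm_num)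
  set B := fderiv ℝ (fderiv ℝ f) 0 with hB
  -- Symmetry makes `B z` the derivative of `(1/2) B z z`.
  have hsymm : ∀ v w, B v w = B w v := fun v w =>
    second_derivative_symmetric (f := f) (f' := fderiv ℝ f) (fun y => (hd y).hasFDerivAt)
      (hd' 0).hasFDerivAt v w
  have h1 : ∀ y, fderiv ℝ f y = fderiv ℝ f 0 + B y := by
    intro y
    have : ∀ z, HasFDerivAt (fun z => fderiv ℝ f z - B z) (0 : E →L[ℝ] E →L[ℝ] ℝ) z := fun z => by
      have := (hd' z).hasFDerivAt.sub (B.hasFDerivAt (x := z))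
      rwa [hc z, sub_self] at this
    have := is_const_of_fderiv_eq_zero (𝕜 := ℝ) (fun z => (this z).differentiableAt)
      (fun z => (this z).fderiv) y 0
    simp only [map_zero, sub_zero] at this
    rw [← this]; abel
  have h2 : ∀ z, HasFDerivAt (fun z => f z - (fderiv ℝ f 0 z + (1 / 2 : ℝ) * B z z))
      (0 : E →L[ℝ] ℝ) z := fun z => by
    have hBz : HasFDerivAt (fun z => B z z) (B.flip z + B z) z := by
      have := (B.hasFDerivAt (x := z)).clm_apply (hasFDerivAt_id z)
      refine this.congr_fderiv ?_
      ext v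
      simp [add_comm]
    have := (hd z).hasFDerivAt.sub
      ((ContinuousLinearMap.hasFDerivAt (fderiv ℝ f 0) (x := z)).add (hBz.const_mul (1 / 2 : ℝ)))
    refine this.congr_fderiv ?_
    ext v
    simp [h1 z, hsymm v z]
    ring
  have := is_const_of_fderiv_eq_zero (𝕜 := ℝ) (fun z => (h2 z).differentiableAt)
    (fun z => (h2 z).fderiv) x 0
  simp at this
  simp
  linarith

/-- A `C²` function with bounded Hessian whose third differences vanish in all the coordinate
directions of a finite product is a quadratic polynomial. -/
theorem eq_quadratic_of_thirdDiff_single_eq_zero {ι : Type*} [Fintype ι] [DecidableEq ι]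
    {f : (ι → E) → ℝ} (hf : ContDiff ℝ 2 f) (hb : HasBoundedHessian f)
    (h3 : ∀ (i : ι) (h : E) (x : ι → E), thirdDiff f x (Pi.single i h) = 0) (x : ι → E) :
    f x = f 0 + fderiv ℝ f 0 x + ((1 / 2 : ℝ) • fderiv ℝ (fderiv ℝ f) 0) x x := by
  refine eq_quadratic_of_hessian_const hf (fun y => ?_) x
  -- The point `y` is reached from `0` one block at a time, each translation preserving the Hessian.
  have : ∀ s : Finset ι, fderiv ℝ (fderiv ℝ f) (∑ i ∈ s, Pi.single i (y i)) =
      fderiv ℝ (fderiv ℝ f) 0 := by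
    intro s
    induction s using Finset.induction_on with
    | empty => simp
    | insert i s hi ih =>
      rw [Finset.sum_insert hi, add_comm, hessian_add_eq_of_thirdDiff_eq_zero hf hb (h3 i (y i)), ih]
  simpa [Finset.univ_sum_single] using this Finset.univ

/-- Lipschitz bounds pass through sums and linear substitutions, so symmetrization needs no
second-order chain rule. -/
theorem hasBoundedHessian_iff_lipschitz {f : E → ℝ} (hf : ContDiff ℝ 2 f) :
    HasBoundedHessian f ↔ ∃ K, LipschitzWith K (fderiv ℝ f) := by
  have hd' : Differentiable ℝ (fderiv ℝ f) :=
    (hf.fderiv_right (m := 1) (by norm_num)).differentiable (by norm_num)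
  constructor
  · rintro ⟨C, hC⟩
    exact ⟨C.toNNReal, lipschitzWith_of_nnnorm_fderiv_le hd' fun x => by
      rw [← NNReal.coe_le_coe, coe_nnnorm]
      exact (hC x).trans (Real.le_coe_toNNReal C)⟩
  · rintro ⟨K, hK⟩
    exact ⟨K, fun x => norm_fderiv_le_of_lipschitz ℝ hK⟩

/-- A function with bounded Hessian grows at most quadratically. -/
theorem HasBoundedHessian.exists_norm_le {f : E → ℝ} (hf : ContDiff ℝ 2 f)
    (hb : HasBoundedHessian f) : ∃ C : ℝ, ∀ x, ‖f x‖ ≤ C * (1 + ‖x‖ ^ 2) := by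
  obtain ⟨K, hK⟩ := (hasBoundedHessian_iff_lipschitz hf).1 hb
  have hd : Differentiable ℝ f := hf.differentiable (by norm_num)
  refine ⟨‖f 0‖ + ‖fderiv ℝ f 0‖ + K, fun x => ?_⟩
  have hx : ‖f x - f 0‖ ≤ (‖fderiv ℝ f 0‖ + K * ‖x‖) * ‖x - 0‖ := by
    refine (convex_closedBall (0 : E) ‖x‖).norm_image_sub_le_of_norm_fderiv_le (𝕜 := ℝ)
      (fun z _ => hd z) (fun z hz => ?_) (by simp) (by simp)
    rw [mem_closedBall_zero_iff] at hz
    have h1 := hK.norm_sub_le z 0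
    rw [sub_zero] at h1
    calc ‖fderiv ℝ f z‖ = ‖fderiv ℝ f 0 + (fderiv ℝ f z - fderiv ℝ f 0)‖ := by congr 1; abel
      _ ≤ ‖fderiv ℝ f 0‖ + ‖fderiv ℝ f z - fderiv ℝ f 0‖ := norm_add_le _ _
      _ ≤ ‖fderiv ℝ f 0‖ + K * ‖x‖ := by
        gcongr
        exact h1.trans (by gcongr)
  rw [sub_zero] at hx
  have h2 : ‖f x‖ ≤ ‖f 0‖ + ‖f x - f 0‖ := by
    calc ‖f x‖ = ‖f 0 + (f x - f 0)‖ := by congr 1; abel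
      _ ≤ _ := norm_add_le _ _
  have hL := norm_nonneg (fderiv ℝ f 0)
  have hK0 : (0 : ℝ) ≤ K := K.2
  have hx0 := norm_nonneg x
  have h00 := norm_nonneg (f 0)
  nlinarith [mul_nonneg hL (sq_nonneg (‖x‖ - 1)), mul_nonneg hL (sq_nonneg ‖x‖),
    mul_nonneg h00 (sq_nonneg ‖x‖)]

end Calculus

/-! ### Cutting the cube into cells and building step maps. -/

section StepMaps

/-- The unit interval can be split into measurable cells of prescribed lengths. -/
theorem exists_measurable_label_Ico {J : Type*} [Nonempty J] [DecidableEq J] [MeasurableSpace J]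
    (w : J → NNReal) (s : Finset J) (a : ℝ) :
    ∃ c : ℝ → J, Measurable c ∧ ∀ j, volume (c ⁻¹' {j} ∩ Set.Ico a (a + ∑ i ∈ s, (w i : ℝ))) =
      if j ∈ s then (w j : ENNReal) else 0 := by
  induction s using Finset.induction_on generalizing a with
  | empty => exact ⟨fun _ => Classical.arbitrary J, measurable_const, fun j => by simp⟩
  | insert i s hi ih =>
    -- The new label takes the leftmost interval, and the remaining labels start at `a + w i`.
    obtain ⟨c, hc, hcv⟩ := ih (a + w i)
    refine ⟨fun u => if u < a + w i then i else c u,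
      Measurable.ite measurableSet_Iio measurable_const hc, fun j => ?_⟩
    rw [Finset.sum_insert hi, ← add_assoc]
    have hS : 0 ≤ ∑ i ∈ s, (w i : ℝ) := Finset.sum_nonneg fun _ _ => NNReal.coe_nonneg _
    have hw : (0 : ℝ) ≤ w i := NNReal.coe_nonneg _
    have hsplit : (fun u => if u < a + w i then i else c u) ⁻¹' {j} ∩
        Set.Ico a (a + w i + ∑ i ∈ s, (w i : ℝ)) =
        (if j = i then Set.Ico a (a + w i) else ∅) ∪
          (c ⁻¹' {j} ∩ Set.Ico (a + w i) (a + w i + ∑ i ∈ s, (w i : ℝ))) := by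
      ext u
      by_cases hu : u < a + w i <;> by_cases hj : j = i
      · simp [hu, hj, not_le.2 hu]
        intro _; linarith
      · simp [hu, hj, not_le.2 hu, Ne.symm hj]
      · simp [hu, hj, not_lt.1 hu]
        intro _ _; linarith [not_lt.1 hu]
      · simp [hu, hj, not_lt.1 hu]
        intro _ _; linarith [not_lt.1 hu]
    rw [hsplit, measure_union' ?_ (by split_ifs <;> measurability), hcv j]
    · by_cases hj : j = i
      · subst hj
        simp [hi]
      · simp [hj]
    · rw [Set.disjoint_left]
      intro u hu1 hu2
      split_ifs at hu1
      · exact absurd hu1.2 (not_lt.2 hu2.2.1)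
      · exact hu1

variable {d k : ℕ}

theorem unitCube_eq_preimage :
    unitCube d = WithLp.ofLp ⁻¹' (Set.univ.pi fun _ : Fin d => Set.Ioo (0 : ℝ) 1) := by
  ext ω; simp [unitCube]

instance isProbabilityMeasure_cubeMeasure : IsProbabilityMeasure (cubeMeasure d) := by
  constructor
  rw [cubeMeasure, Measure.restrict_apply_univ, unitCube_eq_preimage, (PiLp.volume_preserving_ofLp (Fin d)).measure_preimage
    (MeasurableSet.univ_pi fun _ => measurableSet_Ioo).nullMeasurableSet]
  simp [volume_pi, Measure.pi_pi]

/-- Slicing along one coordinate reduces the cutting of the cube to that of the interval. -/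
theorem measurePreserving_coord_cubeMeasure (i : Fin d) :
    MeasurePreserving (fun ω : EuclideanSpace ℝ (Fin d) => ω i) (cubeMeasure d)
      (volume.restrict (Set.Ioo (0 : ℝ) 1)) := by
  have h1 : MeasurePreserving (WithLp.ofLp : EuclideanSpace ℝ (Fin d) → (Fin d → ℝ)) (cubeMeasure d)
      (volume.restrict (Set.univ.pi fun _ : Fin d => Set.Ioo (0 : ℝ) 1)) := by
    rw [cubeMeasure, unitCube_eq_preimage]
    exact (PiLp.volume_preserving_ofLp (Fin d)).restrict_preimage
      (MeasurableSet.univ_pi fun _ => measurableSet_Ioo)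
  rw [volume_pi, Measure.restrict_pi_pi] at h1
  have : IsProbabilityMeasure ((volume : Measure ℝ).restrict (Set.Ioo (0 : ℝ) 1)) :=
    ⟨by simp⟩
  exact (measurePreserving_eval (fun _ : Fin d => (volume : Measure ℝ).restrict (Set.Ioo (0 : ℝ) 1))
    i).comp h1

/-- The cube can be split into measurable cells of prescribed volumes. -/
theorem exists_measurable_label {J : Type*} [Fintype J] [Nonempty J] [MeasurableSpace J]
    [MeasurableSingletonClass J] (i : Fin d) (w : J → NNReal) (hw : ∑ j, w j = 1) :
    ∃ c : EuclideanSpace ℝ (Fin d) → J, Measurable c ∧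
      ∀ j, cubeMeasure d (c ⁻¹' {j}) = w j := by
  classical
  obtain ⟨c, hc, hcv⟩ := exists_measurable_label_Ico w Finset.univ 0
  have hp := measurePreserving_coord_cubeMeasure i
  refine ⟨c ∘ fun ω => ω i, hc.comp hp.measurable, fun j => ?_⟩
  rw [Set.preimage_comp, hp.measure_preimage (hc (measurableSet_singleton j)).nullMeasurableSet,
    Measure.restrict_congr_set Ioo_ae_eq_Ico,
    Measure.restrict_apply (hc (measurableSet_singleton j))]
  have := hcv j
  rw [← NNReal.coe_sum, hw] at this
  simpa using this

/-- Step maps with prescribed cell volumes: a linear family of elements of `L²` on which the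
functional and the norm are given by finite sums. -/
theorem exists_stepMap {J : Type*} [Fintype J] (i₀ : Fin d) (w : J → NNReal)
    (hw : ∑ j, w j = 1) :
    ∃ X : (J → StateSpace d) →ₗ[ℝ] HilbertH d,
      (∀ (g : (Fin k → StateSpace d) → ℝ) (v : J → StateSpace d),
        localFunctional d k g (X v) = ∑ σ : Fin k → J, (∏ i, (w (σ i) : ℝ)) * g (v ∘ σ)) ∧
      ∀ v, ‖X v‖ ^ 2 = ∑ j, (w j : ℝ) * ‖v j‖ ^ 2 := by
  classical
  have : Nonempty J := by
    by_contra h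
    rw [not_nonempty_iff] at h
    simp at hw
  let : MeasurableSpace J := ⊤
  have : MeasurableSingletonClass J := ⟨fun _ => trivial⟩
  obtain ⟨c, hc, hcv⟩ := exists_measurable_label i₀ w hw
  set ν : Measure J := (cubeMeasure d).map c with hν
  have hcp : MeasurePreserving c (cubeMeasure d) ν := ⟨hc, rfl⟩
  have : IsProbabilityMeasure ν := Measure.isProbabilityMeasure_map hc.aemeasurable
  have hνj : ∀ j, ν {j} = w j := fun j => by
    rw [hν, Measure.map_apply hc (measurableSet_singleton j), hcv]
  have hmem : ∀ v : J → StateSpace d, MemLp v 2 ν := fun v =>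
    MemLp.of_discrete
  have hmem' : ∀ v : J → StateSpace d, MemLp (v ∘ c) 2 (cubeMeasure d) := fun v =>
    (hmem v).comp_measurePreserving hcp
  refine ⟨{ toFun := fun v => (hmem' v).toLp (v ∘ c), map_add' := fun v v' => ?_,
            map_smul' := fun a v => ?_ }, fun g v => ?_, fun v => ?_⟩
  · exact (MemLp.toLp_add (hmem' v) (hmem' v'))
  · exact (MemLp.toLp_const_smul a (hmem' v))
  · have hpi := measurePreserving_pi (fun _ : Fin k => cubeMeasure d) (fun _ : Fin k => ν)
      (fun _ => hcp)
    have hae : (fun ω : Fin k → EuclideanSpace ℝ (Fin d) =>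
        g (fun i => (hmem' v).toLp (v ∘ c) (ω i))) =ᵐ[Measure.pi fun _ : Fin k => cubeMeasure d]
        fun ω => (fun σ : Fin k → J => g (v ∘ σ)) (fun i => c (ω i)) := by
      have := Measure.ae_eq_pi (μ := fun _ : Fin k => cubeMeasure d)
        (fun _ : Fin k => (hmem' v).coeFn_toLp)
      filter_upwards [this] with ω hω
      rw [hω]
      rfl
    change localFunctional d k g ((hmem' v).toLp (v ∘ c)) = _
    rw [localFunctional, integral_congr_ae hae, ← integral_map (f := fun σ : Fin k → J => g (v ∘ σ)) hpi.measurable.aemeasurable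
      (by
        rw [hpi.map_eq]
        exact (measurable_of_finite (fun σ : Fin k → J => g (v ∘ σ))).aestronglyMeasurable), hpi.map_eq,
      integral_fintype (Integrable.of_finite)]
    refine Finset.sum_congr rfl fun σ _ => ?_
    rw [Measure.real, Measure.pi_singleton, ENNReal.toReal_prod, smul_eq_mul]
    simp [hνj]
  · change ‖(hmem' v).toLp (v ∘ c)‖ ^ 2 = _
    have h1 : (hmem' v).toLp (v ∘ c) = Lp.compMeasurePreserving c hcp ((hmem v).toLp v) :=
      (Lp.toLp_compMeasurePreserving (hmem v) hcp).symm
    rw [h1, Lp.norm_compMeasurePreserving, ← real_inner_self_eq_norm_sq, L2.inner_def,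
      integral_fintype (L2.integrable_inner _ _)]
    refine Finset.sum_congr rfl fun j _ => ?_
    rw [Measure.real, hνj, smul_eq_mul]
    -- On a null cell the chosen representative may differ from `v j`, but the weight removes that
    -- term.
    by_cases hj : w j = 0
    · simp [hj]
    · have : (hmem v).toLp v j = v j := by
        have h2 := (hmem v).coeFn_toLp
        by_contra hne
        have h3 : ν {j} = 0 := measure_mono_null (by
          rintro _ rfl
          exact hne) (ae_iff.1 h2)
        rw [hνj] at h3
        exact hj (by exact_mod_cast h3)
      rw [this, real_inner_self_eq_norm_sq]
      simp

end StepMaps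

/-! ### Isolating permutations by inclusion–exclusion over cells. -/

section Polarization

variable {k : ℕ}

/-- The weights `1` on the background cell, `t` on the cell `i₀`, and the indicator of `S` on the
other cells. -/
def cellWeight (i₀ : Fin k) (t : NNReal) (S : Finset (Fin k)) : Option (Fin k) → NNReal
  | none => 1
  | some j => if j = i₀ then t else if j ∈ S then 1 else 0

theorem cellWeight_insert_of_ne (i₀ : Fin k) (t : NNReal) (S : Finset (Fin k)) {j : Fin k}
    {x : Option (Fin k)} (hx : x ≠ some j) :
    cellWeight i₀ t (insert j S) x = cellWeight i₀ t S x := by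
  rcases x with _ | i
  · rfl
  · have : i ≠ j := fun h => hx (by rw [h])
    simp [cellWeight, this]

/-- If `σ` misses cell `j`, adding `j` to `S` changes only the sign, so the terms cancel in pairs.
-/
theorem sum_alternating_prod_cellWeight_eq_zero (i₀ : Fin k) (t : NNReal)
    (σ : Fin k → Option (Fin k)) {j : Fin k} (hj : j ≠ i₀) (hσ : some j ∉ Set.range σ) :
    ∑ S ∈ (Finset.univ.erase i₀).powerset,
      (-1 : ℝ) ^ S.card * ∏ i, (cellWeight i₀ t S (σ i) : ℝ) = 0 := by
  have hmem : j ∉ (Finset.univ.erase i₀).erase j := Finset.notMem_erase _ _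
  rw [← Finset.insert_erase (Finset.mem_erase.2 ⟨hj, Finset.mem_univ j⟩),
    Finset.sum_powerset_insert hmem, ← Finset.sum_add_distrib]
  refine Finset.sum_eq_zero fun S hS => ?_
  have hjS : j ∉ S := fun h => hmem (Finset.mem_powerset.1 hS h)
  have : ∀ i, cellWeight i₀ t (insert j S) (σ i) = cellWeight i₀ t S (σ i) := fun i =>
    cellWeight_insert_of_ne i₀ t S fun h => hσ ⟨i, h⟩
  simp only [this, Finset.card_insert_of_notMem hjS, pow_succ]
  ring

/-- A permutation visits every cell, so only the full set `S`, of cardinality `k - 1`, contributes.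
-/
theorem sum_alternating_prod_cellWeight_perm (i₀ : Fin k) (t : NNReal) (τ : Equiv.Perm (Fin k)) :
    ∑ S ∈ (Finset.univ.erase i₀).powerset,
      (-1 : ℝ) ^ S.card * ∏ i, (cellWeight i₀ t S (some (τ i)) : ℝ) = (-1) ^ (k - 1) * t := by
  have hprod : ∀ S, ∏ i, (cellWeight i₀ t S (some (τ i)) : ℝ) =
      t * ∏ j ∈ Finset.univ.erase i₀, if j ∈ S then 1 else 0 := by
    intro S
    rw [Equiv.prod_comp τ (fun j => (cellWeight i₀ t S (some j) : ℝ)),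
      ← Finset.mul_prod_erase _ _ (Finset.mem_univ i₀)]
    congr 1
    · simp [cellWeight]
    · refine Finset.prod_congr rfl fun j hj => ?_
      simp only [cellWeight, if_neg (Finset.ne_of_mem_erase hj)]
      split_ifs <;> simp
  rw [Finset.sum_eq_single (Finset.univ.erase i₀)]
  · rw [hprod, Finset.prod_congr rfl fun j hj => if_pos hj]
    simp
  · intro S hS hne
    obtain ⟨j, hj, hjS⟩ := Finset.exists_of_ssubset
      (Finset.ssubset_iff_subset_ne.2 ⟨Finset.mem_powerset.1 hS, hne⟩)
    rw [hprod, Finset.prod_eq_zero hj (if_neg hjS)]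
    simp
  · simp

/-- Polarization: the alternating sum over the background cells isolates the permutations. -/
theorem sum_alternating_cellWeight (i₀ : Fin k) (t : NNReal) (T : (Fin k → Option (Fin k)) → ℝ)
    (hT : ∀ σ, some i₀ ∉ Set.range σ → T σ = 0) :
    ∑ S ∈ (Finset.univ.erase i₀).powerset, (-1 : ℝ) ^ S.card *
      ∑ σ, (∏ i, (cellWeight i₀ t S (σ i) : ℝ)) * T σ =
    (-1) ^ (k - 1) * t * ∑ τ : Equiv.Perm (Fin k), T (fun i => some (τ i)) := by
  classical
  have hswap : ∑ S ∈ (Finset.univ.erase i₀).powerset, (-1 : ℝ) ^ S.card *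
      ∑ σ, (∏ i, (cellWeight i₀ t S (σ i) : ℝ)) * T σ =
      ∑ σ, (∑ S ∈ (Finset.univ.erase i₀).powerset, (-1 : ℝ) ^ S.card *
        ∏ i, (cellWeight i₀ t S (σ i) : ℝ)) * T σ := by
    simp only [Finset.mul_sum, Finset.sum_mul]
    rw [Finset.sum_comm]
    simp only [mul_assoc]
  rw [hswap, Finset.mul_sum]
  symm
  refine Finset.sum_of_injOn (fun (τ : Equiv.Perm (Fin k)) i => some (τ i)) ?_ ?_ ?_ ?_
  · intro τ _ τ' _ h
    ext i
    have := congrFun h i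
    simp only [Option.some.injEq] at this
    rw [this]
  · intro τ _
    simp
  · intro σ _ hσ
    -- With `k` arguments and `k` cells to hit, `σ` hits each exactly once and never the background.
    by_cases hall : ∀ j, some j ∈ Set.range σ
    · exfalso
      choose ρ hρ using hall
      have hinj : Function.Injective ρ := fun a b hab => by
        have := hρ a
        rw [hab, hρ b] at this
        exact (Option.some.inj this).symm
      refine hσ ⟨(Equiv.ofBijective ρ (Finite.injective_iff_bijective.1 hinj)).symm, by simp, ?_⟩
      funext i
      obtain ⟨j, rfl⟩ := (Finite.injective_iff_surjective.1 hinj) i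
      simp only [hρ]
      rw [Option.some.injEq, Equiv.symm_apply_eq]
      rfl
    · push Not at hall
      obtain ⟨j, hj⟩ := hall
      by_cases hji : j = i₀
      · rw [hT σ (hji ▸ hj), mul_zero]
      · rw [sum_alternating_prod_cellWeight_eq_zero i₀ t σ hji hj, zero_mul]
  · intro τ _
    rw [sum_alternating_prod_cellWeight_perm]

theorem cellWeight_le_one (i₀ : Fin k) {t : NNReal} (ht : t ≤ 1) (S : Finset (Fin k))
    (x : Option (Fin k)) : cellWeight i₀ t S x ≤ 1 := by
  rcases x with _ | j
  · exact le_rfl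
  · simp only [cellWeight]
    split_ifs
    · exact ht
    · exact le_rfl
    · exact zero_le_one

theorem one_le_sum_cellWeight (i₀ : Fin k) (t : NNReal) (S : Finset (Fin k)) :
    1 ≤ ∑ x, cellWeight i₀ t S x :=
  Finset.single_le_sum (f := cellWeight i₀ t S) (fun _ _ => zero_le) (Finset.mem_univ none)

theorem sum_cellWeight_le (i₀ : Fin k) {t : NNReal} (ht : t ≤ 1) (S : Finset (Fin k)) :
    ∑ x, cellWeight i₀ t S x ≤ k + 1 := by
  refine (Finset.sum_le_card_nsmul _ _ 1 fun x _ => cellWeight_le_one i₀ ht S x).trans ?_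
  simp

end Polarization

/-! ### Vanishing of the third differences of the symmetrization. -/

section Main

variable {d k : ℕ}

theorem thirdDiff_zero_right {E F : Type*} [NormedAddCommGroup E] [NormedSpace ℝ E]
    [NormedAddCommGroup F] [NormedSpace ℝ F] (f : E → F) (x : E) : thirdDiff f x 0 = 0 := by
  simp only [thirdDiff, smul_zero, add_zero]
  module

/-- Third differences of the functional on step maps. -/
theorem abs_sum_cellWeight_thirdDiff_le (l : Fin d) {α : ℝ} (hα : 0 ≤ α)
    {g : (Fin k → StateSpace d) → ℝ} (hΦ : IsC2AlphaLoc α (localFunctional d k g))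
    (i₀ : Fin k) (v : Option (Fin k) → StateSpace d) (h : StateSpace d) :
    ∃ D : ℝ, 0 ≤ D ∧ ∀ (s : NNReal), s ≤ 1 → ∀ S : Finset (Fin k),
      |∑ σ : Fin k → Option (Fin k), (∏ i, (cellWeight i₀ (s ^ 2) S (σ i) : ℝ)) *
        thirdDiff g (v ∘ σ) ((Pi.single (some i₀) h : Option (Fin k) → StateSpace d) ∘ σ)| ≤
      D * ((s : ℝ) ^ 2 * (s * ‖h‖) ^ α) := by
  set R : ℝ := ∑ j, ‖v j‖ ^ 2 with hR
  have hR0 : 0 ≤ R := Finset.sum_nonneg fun _ _ => sq_nonneg _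
  -- The radius depends on neither `s` nor `S`, so one constant `C` serves all step maps. The `+ 1`
  -- only makes it positive.
  obtain ⟨C, hC0, hC⟩ := hΦ.abs_thirdDiff_le hα (r := √R + 3 * ‖h‖ + 1) (by positivity)
  refine ⟨(k + 1) ^ k * (C * ‖h‖ ^ 2), by positivity, fun s hs S => ?_⟩
  have ht : s ^ 2 ≤ 1 := pow_le_one₀ zero_le hs
  set W := cellWeight i₀ (s ^ 2) S
  set N : NNReal := ∑ x, W x with hN
  -- The background cell gives `N ≥ 1`, so normalizing to total volume one never enlarges a weight.
  have hN1 : 1 ≤ N := one_le_sum_cellWeight _ _ _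
  have hN0 : N ≠ 0 := (zero_lt_one.trans_le hN1).ne'
  have hw1 : ∑ x, W x / N = 1 := by rw [← Finset.sum_div, div_self hN0]
  obtain ⟨X, hX, hXn⟩ := exists_stepMap (k := k) l (fun x => W x / N) hw1
  set δ : Option (Fin k) → StateSpace d := Pi.single (some i₀) h with hδ
  have hle : ∀ x, W x / N ≤ W x := fun x => div_le_self zero_le hN1
  have hXv : ‖X v‖ ≤ √R := by
    refine Real.le_sqrt_of_sq_le ?_
    rw [hXn, hR]
    refine Finset.sum_le_sum fun j _ => mul_le_of_le_one_left (sq_nonneg _) ?_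
    exact_mod_cast (hle j).trans (cellWeight_le_one i₀ ht S j)
  have hXδ : ‖X δ‖ ≤ s * ‖h‖ := by
    refine (pow_le_pow_iff_left₀ (norm_nonneg _) (by positivity) two_ne_zero).1 ?_
    rw [hXn, Finset.sum_eq_single (some i₀)]
    · rw [hδ, Pi.single_eq_same, mul_pow]
      gcongr
      have hWi : W (some i₀) = s ^ 2 := if_pos rfl
      exact_mod_cast (hle (some i₀)).trans_eq hWi
    · intro j _ hj
      simp [hδ, Pi.single_eq_of_ne hj]
    · simp
  have hs1 : (s : ℝ) ≤ 1 := by exact_mod_cast hs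
  have hXδ' : ‖X δ‖ ≤ ‖h‖ := hXδ.trans (mul_le_of_le_one_left (norm_nonneg _) hs1)
  have key := hC (X v) (X δ) (by linarith)
  have hexp : thirdDiff (localFunctional d k g) (X v) (X δ) =
      ∑ σ : Fin k → Option (Fin k), (∏ i, ((W (σ i) / N : NNReal) : ℝ)) *
        thirdDiff g (v ∘ σ) (δ ∘ σ) := by
    simp only [thirdDiff, ← map_smul, ← map_add, hX, smul_eq_mul, Finset.mul_sum,
      ← Finset.sum_sub_distrib, ← Finset.sum_add_distrib]
    refine Finset.sum_congr rfl fun σ _ => ?_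
    have e : ∀ c : ℝ, (v + c • δ) ∘ σ = v ∘ σ + c • (δ ∘ σ) := fun c => rfl
    have e' : (v + δ) ∘ σ = v ∘ σ + δ ∘ σ := rfl
    rw [e, e, e']
    ring
  -- Each product has `k` weights, so undoing the `S`-dependent normalization costs `N ^ k`, at most
  -- `(k + 1) ^ k`.
  have hscale : ∑ σ : Fin k → Option (Fin k), (∏ i, (W (σ i) : ℝ)) *
      thirdDiff g (v ∘ σ) (δ ∘ σ) =
      (N : ℝ) ^ k * thirdDiff (localFunctional d k g) (X v) (X δ) := by
    rw [hexp, Finset.mul_sum]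
    refine Finset.sum_congr rfl fun σ _ => ?_
    have hNr : (N : ℝ) ≠ 0 := by exact_mod_cast hN0
    simp only [NNReal.coe_div, Finset.prod_div_distrib, Finset.prod_const, Finset.card_univ,
      Fintype.card_fin]
    field_simp
  rw [hscale, abs_mul, abs_of_nonneg (by positivity)]
  have hNk : (N : ℝ) ≤ k + 1 := by exact_mod_cast sum_cellWeight_le i₀ ht S
  calc (N : ℝ) ^ k * |thirdDiff (localFunctional d k g) (X v) (X δ)|
      ≤ (k + 1) ^ k * (C * ((s * ‖h‖) ^ 2 * (s * ‖h‖) ^ α)) := by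
        gcongr
        exact key.trans (by gcongr)
    _ = _ := by ring

theorem sum_perm_thirdDiff_eq_zero {α : ℝ} (hα : 0 < α)
    {g : (Fin k → StateSpace d) → ℝ} (hΦ : IsC2AlphaLoc α (localFunctional d k g))
    (i₀ : Fin k) (h : StateSpace d) (a : Fin k → StateSpace d) :
    ∑ τ : Equiv.Perm (Fin k), thirdDiff g (fun i => a (τ i))
      (fun i => (Pi.single i₀ h : Fin k → StateSpace d) (τ i)) = 0 := by
  -- For `d = 0` there is no coordinate to slice along, but every step `h` is zero.
  rcases isEmpty_or_nonempty (Fin d) with hd | ⟨⟨l⟩⟩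
  · refine Finset.sum_eq_zero fun τ _ => ?_
    convert thirdDiff_zero_right g _
    ext j
    exact isEmptyElim j
  -- The background value is immaterial: the terms that survive polarization never visit `none`.
  set v : Option (Fin k) → StateSpace d := fun x => x.elim 0 a
  set δ : Option (Fin k) → StateSpace d := Pi.single (some i₀) h with hδ
  obtain ⟨D, hD0, hD⟩ := abs_sum_cellWeight_thirdDiff_le l hα.le hΦ i₀ v h
  set Q : ℝ := ∑ τ : Equiv.Perm (Fin k), thirdDiff g (fun i => a (τ i))
      (fun i => (Pi.single i₀ h : Fin k → StateSpace d) (τ i)) with hQ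
  -- The factor `s²` on both sides cancels: one visit to cell `i₀` on the left, the squared norm of
  -- the perturbation on the right. Only the Hölder gain remains.
  have hbound : ∀ s : NNReal, 0 < s → s ≤ 1 → |Q| ≤
      ((Finset.univ.erase i₀).powerset.card : ℝ) * D * (s * ‖h‖) ^ α := by
    intro s hs0 hs1
    have hpol := sum_alternating_cellWeight i₀ (s ^ 2)
      (fun σ => thirdDiff g (v ∘ σ) (δ ∘ σ)) (fun σ hσ => by
        have : δ ∘ σ = 0 := by
          funext i
          exact Pi.single_eq_of_ne (fun h => hσ ⟨i, h⟩) _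
        simp only [this, thirdDiff_zero_right])
    have hQ' : ∑ τ : Equiv.Perm (Fin k), thirdDiff g (v ∘ fun i => some (τ i))
        (δ ∘ fun i => some (τ i)) = Q := by
      refine Finset.sum_congr rfl fun τ _ => ?_
      congr 1
      funext i
      simp only [hδ, Function.comp_apply, Pi.single_apply, Option.some.injEq]
    rw [hQ'] at hpol
    have h1 : (s : ℝ) ^ 2 * |Q| ≤
        ((Finset.univ.erase i₀).powerset.card : ℝ) * (D * ((s : ℝ) ^ 2 * (s * ‖h‖) ^ α)) := by
      calc (s : ℝ) ^ 2 * |Q| = |(-1) ^ (k - 1) * ((s ^ 2 : NNReal) : ℝ) * Q| := by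
            rw [abs_mul, abs_mul, abs_pow, abs_neg, abs_one, one_pow, one_mul, NNReal.abs_eq,
              NNReal.coe_pow]
        _ ≤ _ := by
            rw [← hpol, ← nsmul_eq_mul]
            refine (Finset.abs_sum_le_sum_abs _ _).trans
              (Finset.sum_le_card_nsmul _ _ _ fun S _ => ?_)
            rw [abs_mul, abs_pow, abs_neg, abs_one, one_pow, one_mul]
            exact hD s hs1 S
    have hs : (0 : ℝ) < (s : ℝ) ^ 2 := by positivity
    refine le_of_mul_le_mul_left (h1.trans (le_of_eq ?_)) hs
    ring
  have hlim : Filter.Tendsto (fun s : ℝ => ((Finset.univ.erase i₀).powerset.card : ℝ) * D *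
      (s * ‖h‖) ^ α) (nhdsWithin 0 (Set.Ioi 0)) (nhds 0) := by
    have : ContinuousAt (fun s : ℝ => ((Finset.univ.erase i₀).powerset.card : ℝ) * D *
      (s * ‖h‖) ^ α) 0 :=
      continuousAt_const.mul ((continuousAt_id.mul continuousAt_const).rpow_const (Or.inr hα.le))
    have h0 := this.tendsto
    simp only [zero_mul, Real.zero_rpow hα.ne', mul_zero] at h0
    exact h0.mono_left nhdsWithin_le_nhds
  have hQ0 : |Q| ≤ 0 := by
    refine ge_of_tendsto hlim ?_
    filter_upwards [Ioc_mem_nhdsGT (zero_lt_one' ℝ)] with s hs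
    exact hbound ⟨s, hs.1.le⟩ hs.1 hs.2
  exact abs_nonpos_iff.1 hQ0

theorem thirdDiff_symmetrization_eq_zero {α : ℝ} (hα : 0 < α)
    {g : (Fin k → StateSpace d) → ℝ} (hΦ : IsC2AlphaLoc α (localFunctional d k g))
    (i₀ : Fin k) (h : StateSpace d) (a : Fin k → StateSpace d) :
    thirdDiff (symmetrization d k g) a (Pi.single i₀ h) = 0 := by
  have := sum_perm_thirdDiff_eq_zero hα hΦ i₀ h a
  simp only [thirdDiff, Finset.sum_sub_distrib, Finset.sum_add_distrib, ← Finset.smul_sum] at this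
  simp only [thirdDiff, symmetrization, Pi.add_apply, Pi.smul_apply]
  rw [smul_eq_mul, smul_eq_mul] at *
  simp only [Pi.add_def, Pi.smul_def] at this
  linear_combination (1 / (k.factorial : ℝ)) * this

end Main

/-! ### Quadraticity of the symmetrization, and quadratic functions as polynomials. -/

section Symmetrization

variable {d k : ℕ}

/-- The permutation of the arguments, as a continuous linear map. -/
noncomputable def permCLM (d : ℕ) {k : ℕ} (τ : Equiv.Perm (Fin k)) :
    (Fin k → StateSpace d) →L[ℝ] (Fin k → StateSpace d) :=
  ContinuousLinearMap.pi fun i => ContinuousLinearMap.proj (τ i)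

theorem symmetrization_eq (g : (Fin k → StateSpace d) → ℝ) :
    symmetrization d k g = fun q =>
      (1 / (k.factorial : ℝ)) • ∑ τ : Equiv.Perm (Fin k), g (permCLM d τ q) := rfl

theorem contDiff_symmetrization {g : (Fin k → StateSpace d) → ℝ} (hg : ContDiff ℝ 2 g) :
    ContDiff ℝ 2 (symmetrization d k g) := by
  rw [symmetrization_eq]
  exact (ContDiff.sum fun τ _ => hg.comp (permCLM d τ).contDiff).const_smul _

theorem hasBoundedHessian_symmetrization {g : (Fin k → StateSpace d) → ℝ} (hg : ContDiff ℝ 2 g)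
    (hb : HasBoundedHessian g) : HasBoundedHessian (symmetrization d k g) := by
  rw [hasBoundedHessian_iff_lipschitz (contDiff_symmetrization hg)]
  obtain ⟨K, hK⟩ := (hasBoundedHessian_iff_lipschitz hg).1 hb
  have hd : Differentiable ℝ g := hg.differentiable (by norm_num)
  have hfd : fderiv ℝ (symmetrization d k g) = fun q =>
      (1 / (k.factorial : ℝ)) • ∑ τ : Equiv.Perm (Fin k),
        (fderiv ℝ g (permCLM d τ q)).comp (permCLM d τ) := by
    funext q
    refine HasFDerivAt.fderiv ?_
    rw [symmetrization_eq]
    exact (HasFDerivAt.fun_sum fun τ _ =>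
      (hd _).hasFDerivAt.comp q (permCLM d τ).hasFDerivAt).const_smul (1 / (k.factorial : ℝ))
  rw [hfd]
  have h1 : ∀ τ : Equiv.Perm (Fin k), ∃ K', LipschitzWith K'
      fun q => (fderiv ℝ g (permCLM d τ q)).comp (permCLM d τ) := fun τ =>
    ⟨_, ((ContinuousLinearMap.compL ℝ _ _ ℝ).flip (permCLM d τ)).lipschitz.comp
      (hK.comp (permCLM d τ).lipschitz)⟩
  choose K' hK' using h1
  have h2 : ∀ s : Finset (Equiv.Perm (Fin k)), ∃ K'', LipschitzWith K''
      fun q => ∑ τ ∈ s, (fderiv ℝ g (permCLM d τ q)).comp (permCLM d τ) := by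
    intro s
    induction s using Finset.induction_on with
    | empty => exact ⟨0, by simp⟩
    | insert τ s hτ ih =>
      obtain ⟨L, hL⟩ := ih
      exact ⟨K' τ + L, by simpa only [Finset.sum_insert hτ] using (hK' τ).add hL⟩
  obtain ⟨L, hL⟩ := h2 Finset.univ
  exact ⟨_, (lipschitzWith_smul (1 / (k.factorial : ℝ))).comp hL⟩

/-- The quadratic function with coefficients `c`, `L`, `B`. -/
noncomputable def quadraticFun {E : Type*} [NormedAddCommGroup E] [NormedSpace ℝ E]
    (p : ℝ × (E →L[ℝ] ℝ) × (E →L[ℝ] E →L[ℝ] ℝ)) (q : E) : ℝ :=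
  p.1 + p.2.1 q + p.2.2 q q

/-- If the functional is of class `C^{2,α}_loc`, then the symmetrized integrand is quadratic. -/
theorem exists_symmetrization_eq_quadraticFun {α : ℝ} (hα : 0 < α)
    {g : (Fin k → StateSpace d) → ℝ} (hg : IsAdmissibleIntegrand d k α g)
    (hΦ : IsC2AlphaLoc α (localFunctional d k g)) :
    ∃ p, symmetrization d k g = quadraticFun p := by
  refine ⟨(symmetrization d k g 0, fderiv ℝ (symmetrization d k g) 0,
    (1 / 2 : ℝ) • fderiv ℝ (fderiv ℝ (symmetrization d k g)) 0), funext fun q => ?_⟩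
  exact eq_quadratic_of_thirdDiff_single_eq_zero (contDiff_symmetrization hg.1.1)
    (hasBoundedHessian_symmetrization hg.1.1 hg.2)
    (fun i h x => thirdDiff_symmetrization_eq_zero hα hΦ i h x) q

theorem stateSpace_pi_eq_sum_single (q : Fin k → StateSpace d) :
    q = ∑ ij : Fin k × Fin d,
      q ij.1 ij.2 • (Pi.single ij.1 (EuclideanSpace.single ij.2 (1 : ℝ)) :
        Fin k → StateSpace d) := by
  rw [Fintype.sum_prod_type]
  ext i j
  simp [Finset.sum_apply, Pi.single_apply, apply_ite]

theorem isPolynomialDegreeLeTwo_quadraticFun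
    (p : ℝ × ((Fin k → StateSpace d) →L[ℝ] ℝ) ×
      ((Fin k → StateSpace d) →L[ℝ] (Fin k → StateSpace d) →L[ℝ] ℝ)) :
    IsPolynomialDegreeLeTwo d k (quadraticFun p) := by
  obtain ⟨c, L, B⟩ := p
  set e : Fin k × Fin d → (Fin k → StateSpace d) := fun ij =>
    Pi.single ij.1 (EuclideanSpace.single ij.2 (1 : ℝ)) with he
  refine ⟨MvPolynomial.C c + ∑ a, MvPolynomial.C (L (e a)) * MvPolynomial.X a +
    ∑ a, ∑ b, MvPolynomial.C (B (e a) (e b)) * (MvPolynomial.X a * MvPolynomial.X b), ?_,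
    fun q => ?_⟩
  · refine (MvPolynomial.totalDegree_add _ _).trans (max_le ((MvPolynomial.totalDegree_add _ _).trans
      (max_le (by simp) ?_)) ?_)
    · refine MvPolynomial.totalDegree_finsetSum_le fun a _ => ?_
      refine (MvPolynomial.totalDegree_mul _ _).trans ?_
      simp
    · refine MvPolynomial.totalDegree_finsetSum_le fun a _ => ?_
      refine MvPolynomial.totalDegree_finsetSum_le fun b _ => ?_
      refine (MvPolynomial.totalDegree_mul _ _).trans ?_
      rw [MvPolynomial.totalDegree_C, zero_add]
      refine (MvPolynomial.totalDegree_mul _ _).trans ?_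
      simp
  · have hq : q = ∑ a, q a.1 a.2 • e a := stateSpace_pi_eq_sum_single q
    have hL : L q = ∑ a, L (e a) * q a.1 a.2 := by
      conv_lhs => rw [hq]
      simp [mul_comm]
    have hB : B q q = ∑ a, ∑ b, B (e a) (e b) * (q a.1 a.2 * q b.1 b.2) := by
      conv_lhs => rw [hq]
      simp only [map_sum, map_smul, sum_apply, smul_apply,
        smul_eq_mul, Finset.mul_sum]
      rw [Finset.sum_comm]
      refine Finset.sum_congr rfl fun a _ => Finset.sum_congr rfl fun b _ => ?_
      ring
    simp [quadraticFun, hL, hB]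

theorem contDiff_quadraticFun {E : Type*} [NormedAddCommGroup E] [NormedSpace ℝ E]
    (p : ℝ × (E →L[ℝ] ℝ) × (E →L[ℝ] E →L[ℝ] ℝ)) : ContDiff ℝ 2 (quadraticFun p) := by
  unfold quadraticFun
  fun_prop

/-- The bilinear form is not assumed symmetric, hence the sum with its flip. Constancy of the
Hessian gives Hölder constant zero, on `L²` as well. -/
theorem hessian_quadraticFun {E : Type*} [NormedAddCommGroup E] [NormedSpace ℝ E]
    (p : ℝ × (E →L[ℝ] ℝ) × (E →L[ℝ] E →L[ℝ] ℝ)) (x : E) :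
    fderiv ℝ (fderiv ℝ (quadraticFun p)) x = p.2.2.flip + p.2.2 := by
  have h1 : fderiv ℝ (quadraticFun p) = fun z => p.2.1 + (p.2.2.flip + p.2.2) z := by
    funext z
    refine HasFDerivAt.fderiv ?_
    have := ((hasFDerivAt_const p.1 z).add p.2.1.hasFDerivAt).add
      ((p.2.2.hasFDerivAt (x := z)).clm_apply (hasFDerivAt_id z))
    refine this.congr_fderiv ?_
    ext v
    simp
    ring
  rw [h1]
  exact ((p.2.2.flip + p.2.2).hasFDerivAt.const_add p.2.1).fderiv

theorem isC2AlphaLoc_quadraticFun {E : Type*} [NormedAddCommGroup E] [NormedSpace ℝ E]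
    (α : ℝ) (p : ℝ × (E →L[ℝ] ℝ) × (E →L[ℝ] E →L[ℝ] ℝ)) : IsC2AlphaLoc α (quadraticFun p) :=
  ⟨contDiff_quadraticFun p, fun _ _ => ⟨0, fun x _ y _ => by
    rw [hessian_quadraticFun, hessian_quadraticFun, sub_self, zero_mul]
    exact (norm_zero (E := E →L[ℝ] E →L[ℝ] ℝ)).le⟩⟩

theorem isAdmissibleIntegrand_quadraticFun (α : ℝ)
    (p : ℝ × ((Fin k → StateSpace d) →L[ℝ] ℝ) ×
      ((Fin k → StateSpace d) →L[ℝ] (Fin k → StateSpace d) →L[ℝ] ℝ)) :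
    IsAdmissibleIntegrand d k α (quadraticFun p) :=
  ⟨isC2AlphaLoc_quadraticFun α p, _, fun x => (congrArg norm (hessian_quadraticFun p x)).le⟩

end Symmetrization

/-! ### Functionals of quadratic integrands on `L²`. -/

section Integration

variable {d k : ℕ}

theorem memLp_eval (x : HilbertH d) (i : Fin k) :
    MemLp (fun ω : Fin k → EuclideanSpace ℝ (Fin d) => x (ω i)) 2
      (Measure.pi fun _ : Fin k => cubeMeasure d) :=
  (Lp.memLp x).comp_measurePreserving (measurePreserving_eval (fun _ : Fin k => cubeMeasure d) i)

/-- A bounded Hessian forces at most quadratic growth, which is integrable along `L²` maps over a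
probability space. -/
theorem integrable_comp_of_quadratic_growth {g : (Fin k → StateSpace d) → ℝ}
    (hg : ContDiff ℝ 2 g) (hb : HasBoundedHessian g) (x : HilbertH d) (τ : Equiv.Perm (Fin k)) :
    Integrable (fun ω : Fin k → EuclideanSpace ℝ (Fin d) => g fun i => x (ω (τ i)))
      (Measure.pi fun _ : Fin k => cubeMeasure d) := by
  obtain ⟨C, hC⟩ := hb.exists_norm_le hg
  have hx : MemLp (fun (ω : Fin k → EuclideanSpace ℝ (Fin d)) (i : Fin k) => x (ω (τ i))) 2
      (Measure.pi fun _ : Fin k => cubeMeasure d) := MemLp.of_eval fun i => memLp_eval x (τ i)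
  refine (((integrable_const (1 : ℝ)).add hx.integrable_norm_pow').const_mul C).mono'
    (hg.continuous.comp_aestronglyMeasurable hx.1) (Filter.Eventually.of_forall fun ω => ?_)
  simpa using hC fun i => x (ω (τ i))

theorem integrable_quadraticFun_comp
    (p : ℝ × ((Fin k → StateSpace d) →L[ℝ] ℝ) ×
      ((Fin k → StateSpace d) →L[ℝ] (Fin k → StateSpace d) →L[ℝ] ℝ)) (x : HilbertH d) :
    Integrable (fun ω : Fin k → EuclideanSpace ℝ (Fin d) => quadraticFun p fun i => x (ω i))
      (Measure.pi fun _ : Fin k => cubeMeasure d) :=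
  integrable_comp_of_quadratic_growth (contDiff_quadraticFun p)
    (isAdmissibleIntegrand_quadraticFun 1 p).2 x 1

theorem localFunctional_perm (g : (Fin k → StateSpace d) → ℝ) (τ : Equiv.Perm (Fin k))
    (x : HilbertH d) :
    ∫ ω : Fin k → EuclideanSpace ℝ (Fin d), g (fun i => x (ω (τ i)))
      ∂(Measure.pi fun _ : Fin k => cubeMeasure d) = localFunctional d k g x := by
  -- The factors are identical, so relabelling preserves the product measure. The inverse appears
  -- because `piCongrLeft` sends entry `τ i` to position `τ.symm (τ i) = i`.
  have h := (measurePreserving_piCongrLeft (fun _ : Fin k => cubeMeasure d) τ.symm)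
  refine Eq.trans ?_ (h.integral_comp' fun ω => g fun i => x (ω i))
  refine integral_congr_ae (Filter.Eventually.of_forall fun ω => ?_)
  simp only [MeasurableEquiv.coe_piCongrLeft]
  congr 1
  funext i
  have := Equiv.piCongrLeft_apply_apply (fun _ : Fin k => EuclideanSpace ℝ (Fin d)) τ.symm ω (τ i)
  rw [Equiv.symm_apply_apply] at this
  exact congrArg x this.symm

theorem localFunctional_symmetrization {g : (Fin k → StateSpace d) → ℝ}
    (hg : ContDiff ℝ 2 g) (hb : HasBoundedHessian g) :
    localFunctional d k (symmetrization d k g) = localFunctional d k g := by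
  funext x
  rw [localFunctional]
  simp only [symmetrization]
  rw [integral_const_mul, integral_finsetSum _ fun τ _ =>
    integrable_comp_of_quadratic_growth hg hb x τ]
  simp only [localFunctional_perm, Finset.sum_const, Finset.card_univ, Fintype.card_perm,
    Fintype.card_fin, nsmul_eq_mul]
  field_simp

/-- The map sending `x` to the function `ω ↦ (x(ω₁), …, x(ω_k))`, from `L²` to `L²`. -/
noncomputable def productLift (d k : ℕ) : HilbertH d →L[ℝ]
    Lp (Fin k → StateSpace d) 2 (Measure.pi fun _ : Fin k => cubeMeasure d) :=
  ∑ i : Fin k, ((ContinuousLinearMap.single ℝ (fun _ : Fin k => StateSpace d) i).compLpL 2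
    (Measure.pi fun _ : Fin k => cubeMeasure d)).comp
    (Lp.compMeasurePreservingₗᵢ ℝ (Function.eval i)
      (measurePreserving_eval (fun _ : Fin k => cubeMeasure d) i)).toContinuousLinearMap

theorem coeFn_productLift (x : HilbertH d) :
    productLift d k x =ᵐ[Measure.pi fun _ : Fin k => cubeMeasure d]
      fun ω i => x (ω i) := by
  have h1 : ∀ i : Fin k, ((ContinuousLinearMap.single ℝ (fun _ : Fin k => StateSpace d) i).compLpL 2
    (Measure.pi fun _ : Fin k => cubeMeasure d)) (Lp.compMeasurePreserving (Function.eval i)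
      (measurePreserving_eval (fun _ : Fin k => cubeMeasure d) i) x)
      =ᵐ[Measure.pi fun _ : Fin k => cubeMeasure d] fun ω => Pi.single i (x (ω i)) := by
    intro i
    filter_upwards [ContinuousLinearMap.coeFn_compLpL
      (ContinuousLinearMap.single ℝ (fun _ : Fin k => StateSpace d) i)
      (Lp.compMeasurePreserving (Function.eval i)
        (measurePreserving_eval (fun _ : Fin k => cubeMeasure d) i) x),
      Lp.coeFn_compMeasurePreserving x
        (measurePreserving_eval (fun _ : Fin k => cubeMeasure d) i)] with ω h1 h2
    rw [h1, h2]
    rfl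
  have h2 : productLift d k x = ∑ i : Fin k,
      ((ContinuousLinearMap.single ℝ (fun _ : Fin k => StateSpace d) i).compLpL 2
      (Measure.pi fun _ : Fin k => cubeMeasure d)) (Lp.compMeasurePreserving (Function.eval i)
      (measurePreserving_eval (fun _ : Fin k => cubeMeasure d) i) x) := by
    rw [productLift, sum_apply]
    rfl
  rw [h2]
  filter_upwards [Lp.coeFn_finsetSum Finset.univ (fun i : Fin k =>
      ((ContinuousLinearMap.single ℝ (fun _ : Fin k => StateSpace d) i).compLpL 2
      (Measure.pi fun _ : Fin k => cubeMeasure d)) (Lp.compMeasurePreserving (Function.eval i)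
      (measurePreserving_eval (fun _ : Fin k => cubeMeasure d) i) x)),
    Filter.eventually_all.2 h1] with ω hω hω'
  rw [hω, Finset.sum_apply, Finset.sum_congr rfl fun i _ => hω' i, Finset.univ_sum_single]

/-- The functional of a quadratic integrand is a quadratic function on `L²`. -/
theorem exists_localFunctional_quadraticFun_eq
    (p : ℝ × ((Fin k → StateSpace d) →L[ℝ] ℝ) ×
      ((Fin k → StateSpace d) →L[ℝ] (Fin k → StateSpace d) →L[ℝ] ℝ)) :
    ∃ p', localFunctional d k (quadraticFun p) = quadraticFun p' := by
  obtain ⟨c, L, B⟩ := p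
  set μ := Measure.pi fun _ : Fin k => cubeMeasure d with hμ
  -- Pairing with the constant `1` puts the linear term in the same `L²` pairing form as the
  -- quadratic one, so its continuity comes for free.
  set one : Lp ℝ 2 μ := Lp.const 2 μ (1 : ℝ) with hone
  set P := ((ContinuousLinearMap.lsmul ℝ ℝ (E := ℝ)).flip.comp L).lpPairing μ 2 2 with hP
  refine ⟨(c, (P.flip one).comp (productLift d k),
    ((B.lpPairing μ 2 2).comp (productLift d k)).flip.comp (productLift d k)), ?_⟩
  funext x
  have iL : Integrable (fun ω : Fin k → EuclideanSpace ℝ (Fin d) => L fun i => x (ω i)) μ := by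
    simpa [quadraticFun] using integrable_quadraticFun_comp (0, L, 0) x
  have iB : Integrable (fun ω : Fin k → EuclideanSpace ℝ (Fin d) =>
      B (fun i => x (ω i)) fun i => x (ω i)) μ := by
    simpa [quadraticFun] using integrable_quadraticFun_comp (0, 0, B) x
  have hL : ∫ ω, L (fun i => x (ω i)) ∂μ = P (productLift d k x) one := by
    rw [hP, ContinuousLinearMap.lpPairing_eq_integral]
    refine integral_congr_ae ?_
    filter_upwards [coeFn_productLift (k := k) x, Lp.coeFn_const (p := 2) (μ := μ) (1 : ℝ)]
      with ω h1 h2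
    rw [h1, hone, h2]
    simp
  have hB : ∫ ω, B (fun i => x (ω i)) (fun i => x (ω i)) ∂μ =
      B.lpPairing μ 2 2 (productLift d k x) (productLift d k x) := by
    rw [ContinuousLinearMap.lpPairing_eq_integral]
    refine integral_congr_ae ?_
    filter_upwards [coeFn_productLift (k := k) x] with ω h1
    rw [h1]
  simp only [localFunctional, quadraticFun]
  rw [← hμ, integral_add (f := fun ω => c + L fun i => x (ω i))
    ((integrable_const c).add iL) iB, integral_add (integrable_const c) iL, hL, hB]
  simp

/-- The functional of a quadratic integrand, as a linear function of the coefficients. -/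
noncomputable def quadraticFunctional (d k : ℕ) :
    (ℝ × ((Fin k → StateSpace d) →L[ℝ] ℝ) ×
      ((Fin k → StateSpace d) →L[ℝ] (Fin k → StateSpace d) →L[ℝ] ℝ)) →ₗ[ℝ] (HilbertH d → ℝ) where
  toFun p := localFunctional d k (quadraticFun p)
  map_add' p p' := by
    funext x
    simp only [localFunctional, Pi.add_apply]
    rw [← integral_add (integrable_quadraticFun_comp p x) (integrable_quadraticFun_comp p' x)]
    congr 1
    funext ω
    simp [quadraticFun]
    ring
  map_smul' a p := by
    funext x
    simp only [localFunctional, Pi.smul_apply, RingHom.id_apply, smul_eq_mul]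
    rw [← integral_const_mul]
    congr 1
    funext ω
    simp [quadraticFun]
    ring

end Integration

theorem mainTheorem10 (d k : ℕ) (α : ℝ) (hα0 : 0 < α) (hα1 : α ≤ 1) :
    (∃ V : Submodule ℝ (HilbertH d → ℝ),
      (V : Set (HilbertH d → ℝ)) =
        {Φ | IsC2AlphaLoc α Φ} ∩
          {Φ | ∃ g : (Fin k → StateSpace d) → ℝ,
            IsAdmissibleIntegrand d k α g ∧ Φ = localFunctional d k g} ∧
      FiniteDimensional ℝ V) ∧
    (∀ g : (Fin k → StateSpace d) → ℝ,
      IsAdmissibleIntegrand d k α g → IsC2AlphaLoc α (localFunctional d k g) →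
        IsPolynomialDegreeLeTwo d k (symmetrization d k g)) := by
  refine ⟨⟨LinearMap.range (quadraticFunctional d k), ?_, inferInstance⟩, fun g hg hΦ => ?_⟩
  · ext Φ
    constructor
    · rintro ⟨p, rfl⟩
      refine ⟨?_, quadraticFun p, isAdmissibleIntegrand_quadraticFun α p, rfl⟩
      obtain ⟨p', hp'⟩ := exists_localFunctional_quadraticFun_eq (d := d) (k := k) p
      change IsC2AlphaLoc α (localFunctional d k (quadraticFun p))
      rw [hp']
      exact isC2AlphaLoc_quadraticFun α p'
    · rintro ⟨hΦ, g, hg, rfl⟩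
      obtain ⟨p, hp⟩ := exists_symmetrization_eq_quadraticFun hα0 hg hΦ
      refine ⟨p, ?_⟩
      -- The integrand `g` itself need not be quadratic; replacing it by its symmetrization leaves
      -- the functional unchanged.
      rw [← localFunctional_symmetrization hg.1.1 hg.2, hp]
      rfl
  · obtain ⟨p, hp⟩ := exists_symmetrization_eq_quadraticFun hα0 hg hΦ
    rw [hp]
    exact isPolynomialDegreeLeTwo_quadraticFun p
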